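/- Let $\mathcal M=(S,A,\to,\Rightarrow,s_0)$ be a closed Markov automaton: $S$ and $A$ are finite; probabilistic transitions $s\xrightarrow{\alpha}\mu$ (with $\alpha\in A$ and $\mu$ a distribution on $S$) are all internal and $\mu=\mu^s_\alpha$ is determined by $s$ and $\alpha$; there are finitely many Markovian transitions $s\stackrel{\lambda}{\Rightarrow}s'$ with rates $\lambda>0$; and the outgoing transitions of each state are either all probabilistic or all Markovian. States with Markovian transitions are called Markovian and form the set $MS$. Put $R(s,s')=\sum\{\lambda\mid s\stackrel{\lambda}{\Rightarrow}s'\}$ and $E(s)=\sum_{s'}R(s,s')$. The enabled actions are $Act(s)=\{\bot\}$ for $s\in MS$ and $Act(s)=\{\alpha\mid \exists\mu:\ s\xrightarrow{\alpha}\mu\}$ otherwise. Let $P(s,\bot,s')=R(s,s')/E(s)$ for $s\in MS$ and $P(s,\alpha,s')=\mu^s_\alpha(s')$ for probabilistic transitions. For a set $G\subseteq S$ of goal states let $c_2(s,\bot)=1/E(s)$ for $s\in MS$, $c_1(s,\bot)=1/E(s)$ for $s\in MS\cap G$, and let all other costs be $0$. A sub-automaton is a pair $(S',K)$ with $\emptyset\ne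 S'\subseteq S$ and $\emptyset\neq K(s)\subseteq Act(s)$ for $s\in S'$ such that all transitions of $K$-actions and all Markovian transitions from states of $S'$ lead to $S'$ only. It is an end component if its underlying graph is strongly connected, and a maximal end component if it is not contained in any other end component. Let $(S',K)$ be a maximal end component that is non-Zeno, i.e. contains no end component consisting of probabilistic states only. A stationary deterministic policy on $(S',K)$ is a map $D$ choosing $D(s)\in K(s)$ for each $s\in S'$. It induces the Markov chain on $S'$ with transition probabilities $P(s,D(s),s')$, whose law on paths from $s$ is $\Pr_{s,D}$. A state is transient if with positive probability the chain started there never returns to it, and recurrent otherwise; recurrent classes are the classes of mutually accessible recurrent states. $D$ induces a unichain if there is exactly one recurrent class (plus possibly transient states), and a multichain if there are at least two. The long-run ratio of a path $\pi=s_0s_1\ldots$ is $$\mathcal R(\pi)=\lim_{n\to\infty}\frac{\sum_{i<n}c_1(s_i,D(s_i))}{\sum_{j<n}c_2(s_j,D(s_j))}.$$ Let $D$ be a stationary deterministic policy on $(S',K)$ that induces a multichain. Then there is a stationary deterministic policy $D'$ on $(S',K)$ that induces a unichain and whose long-run ratio is at least as good as that of $D$ from every state. That is, for the minimisation objective there is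 such a $D'$ with $\mathbb E_{s,D'}(\mathcal R)\le\mathbb E_{s,D}(\mathcal R)$ for all $s\in S'$, and for the maximisation objective there is such a $D'$ with $\mathbb E_{s,D'}(\mathcal R)\ge\mathbb E_{s,D}(\mathcal R)$ for all $s\in S'$. Here, for $D$ and for both policies $D'$ and from every state $s \in S'$, the limit $\mathcal R$ exists almost surely and is integrable. -/

import Mathlib

open MeasureTheory ProbabilityTheory Filter Topology

noncomputable section

/-- A closed Markov automaton with finite state space `S` and a finite set `A` of (internal) action
names: every transition is internal, the action names are numbered so that an action enabled in a
state determines its distribution, and by maximal progress the outgoing transitions of a state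
are either all probabilistic or all Markovian. -/
structure MarkovAutomaton (S A : Type*) where
  /-- the initial state -/
  init : S
  /-- the probabilistic transitions `s -α→ μ` -/
  ptrans : S → A → PMF S → Prop
  /-- the Markovian transitions `(s, l, s')` with rate `l` -/
  mtrans : Finset (S × ℝ × S)
  rate_pos : ∀ s l s', (s, l, s') ∈ mtrans → 0 < l
  ptrans_unique : ∀ s α μ ν, ptrans s α μ → ptrans s α ν → μ = ν
  not_both : ∀ s α μ l s', ptrans s α μ → (s, l, s') ∉ mtrans

namespace MarkovAutomaton

variable {S A : Type*} (M : MarkovAutomaton S A)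

/-- The Markovian states. -/
def MS : Set S := {s | ∃ l s', (s, l, s') ∈ M.mtrans}

/-- The set `Act(s)` of enabled actions: `some α` for a probabilistic action `α`, and `none` for the
symbol `⊥` that stands for the delay in a Markovian state. -/
def Act (s : S) : Set (Option A) :=
  {σ | (∃ α μ, σ = some α ∧ M.ptrans s α μ) ∨ (σ = none ∧ s ∈ M.MS)}

open Classical in
/-- The total rate `R(s,s')` of moving from `s` to `s'`. -/
def rate (s s' : S) : ℝ := ∑ x ∈ M.mtrans with x.1 = s ∧ x.2.2 = s', x.2.1

lemma rate_nonneg (M : MarkovAutomaton S A) (s s' : S) : 0 ≤ M.rate s s' := by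
  classical
  unfold rate
  refine Finset.sum_nonneg fun x hx => ?_
  rw [Finset.mem_filter] at hx
  exact (M.rate_pos x.1 x.2.1 x.2.2 hx.1).le

lemma rate_pos_of_mem (M : MarkovAutomaton S A) {s s' : S} {l : ℝ} (h : (s, l, s') ∈ M.mtrans) :
    0 < M.rate s s' := by
  classical
  unfold rate
  refine Finset.sum_pos (fun x hx => ?_) ⟨(s, l, s'), by simp [h]⟩
  rw [Finset.mem_filter] at hx
  exact M.rate_pos x.1 x.2.1 x.2.2 hx.1

lemma exists_mem_of_rate_ne_zero (M : MarkovAutomaton S A) {s s' : S} (h : M.rate s s' ≠ 0) :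
    ∃ l, (s, l, s') ∈ M.mtrans := by
  classical
  obtain ⟨x, hx, -⟩ := Finset.exists_ne_zero_of_sum_ne_zero h
  rw [Finset.mem_filter] at hx
  obtain ⟨h1, h2, h3⟩ := hx
  exact ⟨x.2.1, by rw [← h2, ← h3]; exact h1⟩

variable [Fintype S]

/-- The exit rate `E(s)`. -/
def exitRate (s : S) : ℝ := ∑ s', M.rate s s'

open Classical in
/-- The transition probabilities `P(s,σ,s')` of the decision process `mdp(M)`. -/
def P (s : S) : Option A → S → ℝ
  | none, s' => if s ∈ M.MS then M.rate s s' / M.exitRate s else 0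
  | some α, s' => if h : ∃ μ, M.ptrans s α μ then (h.choose s').toReal else 0

open Classical in
/-- The cost `c₁(s,σ)` of `mdp(M)`: expected residence time in goal states. -/
def cost₁ (G : Set S) (s : S) (σ : Option A) : ℝ :=
  if s ∈ M.MS ∩ G ∧ σ = none then 1 / M.exitRate s else 0

open Classical in
/-- The cost `c₂(s,σ)` of `mdp(M)`: expected residence time. -/
def cost₂ (s : S) (σ : Option A) : ℝ :=
  if s ∈ M.MS ∧ σ = none then 1 / M.exitRate s else 0

lemma exitRate_pos {s : S} (h : s ∈ M.MS) : 0 < M.exitRate s := by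
  obtain ⟨l, s', hl⟩ := h
  exact Finset.sum_pos' (fun t _ => M.rate_nonneg s t) ⟨s', Finset.mem_univ _, M.rate_pos_of_mem hl⟩

lemma P_nonneg (s : S) (σ : Option A) (s' : S) : 0 ≤ M.P s σ s' := by
  cases σ with
  | none =>
    simp only [P]
    split_ifs with h
    · exact div_nonneg (M.rate_nonneg s s') (M.exitRate_pos h).le
    · exact le_rfl
  | some α =>
    simp only [P]
    split_ifs
    · exact ENNReal.toReal_nonneg
    · exact le_rfl

lemma sum_P {s : S} {σ : Option A} (hσ : σ ∈ M.Act s) : ∑ s', M.P s σ s' = 1 := by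
  rcases hσ with ⟨α, μ, rfl, hμ⟩ | ⟨rfl, hs⟩
  · have h : ∃ μ, M.ptrans s α μ := ⟨μ, hμ⟩
    simp only [P, dif_pos h]
    rw [← ENNReal.toReal_sum (fun a _ => PMF.apply_ne_top _ a),
      ← tsum_fintype (L := .unconditional S), PMF.tsum_coe]
    rfl
  · simp only [P, if_pos hs]
    rw [← Finset.sum_div]
    exact div_self (M.exitRate_pos hs).ne'

end MarkovAutomaton

variable {S A : Type*}

/-- A sub-automaton `(S', K)` with nonempty state set `S'` and choice `K(s)` of enabled actions. -/
@[ext]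
structure SubMA (M : MarkovAutomaton S A) where
  /-- the state set `S'` -/
  states : Set S
  /-- the retained actions `K(s)` for `s ∈ S'` -/
  acts : states → Set (Option A)
  states_nonempty : states.Nonempty
  acts_enabled : ∀ s, acts s ⊆ M.Act s
  acts_nonempty : ∀ s, (acts s).Nonempty
  closed_prob : ∀ (s : states) (α : A) (μ : PMF S) (s' : S),
    some α ∈ acts s → M.ptrans s α μ → 0 < μ s' → s' ∈ states
  closed_markov : ∀ (s : states) (l : ℝ) (s' : S), ((s : S), l, s') ∈ M.mtrans → s' ∈ states

namespace SubMA

variable {M : MarkovAutomaton S A} (E : SubMA M)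

/-- The edges of the underlying graph. -/
def Edge (s s' : E.states) : Prop :=
  (∃ α μ, some α ∈ E.acts s ∧ M.ptrans s α μ ∧ 0 < μ s') ∨ ∃ l, ((s : S), l, (s' : S)) ∈ M.mtrans

/-- End components: sub-automata whose underlying graph is strongly connected. -/
def IsEndComponent : Prop := ∀ s s' : E.states, Relation.ReflTransGen E.Edge s s'

/-- Containment `(S', K) ⊆ (S'', K')`. -/
def ContainedIn (E E' : SubMA M) : Prop :=
  ∃ h : E.states ⊆ E'.states, ∀ s : E.states, E.acts s ⊆ E'.acts ⟨s, h s.2⟩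

/-- Maximal end components: those not contained in any other end component. -/
def IsMaximalEndComponent : Prop :=
  E.IsEndComponent ∧ ∀ E' : SubMA M, E'.IsEndComponent → E.ContainedIn E' → E' = E

/-- Non-Zenoness: no end component inside `E` consists of probabilistic states only. Equivalently,
under no policy is there a positive probability of taking only finitely many Markovian
transitions; in particular it holds if there is no cycle of probabilistic transitions. -/
def NonZeno : Prop :=
  ∀ E' : SubMA M, E'.IsEndComponent → E'.ContainedIn E → ∃ s ∈ E'.states, s ∈ M.MS

/-- The state set of a sub-automaton carries the discrete σ-algebra. -/
instance : MeasurableSpace E.states := ⊤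

instance : DiscreteMeasurableSpace E.states := ⟨fun _ => trivial⟩

/-- A stationary deterministic policy on the sub-automaton: it selects an action of `K(s)` in each
state `s`. In a Markovian state there is no choice, as `K(s) = {⊥}` there. -/
structure Policy where
  /-- the selected action -/
  act : E.states → Option A
  act_mem : ∀ s, act s ∈ E.acts s

variable [Fintype S]

lemma P_eq_zero {s : E.states} {σ : Option A} (hσ : σ ∈ E.acts s) {s' : S} (hs' : s' ∉ E.states) :
    M.P s σ s' = 0 := by
  rcases E.acts_enabled s hσ with ⟨α, μ, rfl, hμ⟩ | ⟨rfl, hs⟩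
  · have h : ∃ μ, M.ptrans s α μ := ⟨μ, hμ⟩
    simp only [MarkovAutomaton.P, dif_pos h]
    have h0 : h.choose s' = 0 := by
      by_contra hne
      exact hs' (E.closed_prob s α _ s' hσ h.choose_spec (pos_iff_ne_zero.mpr hne))
    simp [h0]
  · simp only [MarkovAutomaton.P, if_pos hs]
    have h0 : M.rate s s' = 0 := by
      by_contra hne
      obtain ⟨l, hl⟩ := M.exists_mem_of_rate_ne_zero hne
      exact hs' (E.closed_markov s l s' hl)
    simp [h0]

end SubMA

/-- The law on `X^ℕ` of the Markov chain with step distributions `p` and initial state `x`. -/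
def chainLaw {X : Type*} [MeasurableSpace X] [Countable X] [DiscreteMeasurableSpace X]
    (p : X → PMF X) (x : X) : Measure (ℕ → X) :=
  haveI : IsMarkovKernel (Kernel.ofFunOfCountable fun y => (p y).toMeasure) :=
    ⟨fun y => inferInstanceAs (IsProbabilityMeasure (p y).toMeasure)⟩
  Kernel.traj (X := fun _ => X)
    (fun n => (Kernel.ofFunOfCountable fun y => (p y).toMeasure).comap
      (fun h : (Finset.Iic n → X) => h ⟨n, Finset.mem_Iic.mpr le_rfl⟩) (measurable_pi_apply _))
    0 (fun _ => x)

namespace SubMA.Policy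

variable {M : MarkovAutomaton S A} {E : SubMA M} [Fintype S] (D : E.Policy)

lemma sum_step (s : E.states) [Fintype E.states] :
    ∑ t : E.states, ENNReal.ofReal (M.P s (D.act s) t) = 1 := by
  classical
  rw [← ENNReal.ofReal_sum_of_nonneg fun t _ => M.P_nonneg _ _ _]
  have h : ∑ t : E.states, M.P s (D.act s) t = ∑ t : S, M.P s (D.act s) t := by
    rw [← Finset.sum_filter_add_sum_filter_not Finset.univ (· ∈ E.states),
      Finset.sum_eq_zero (s := Finset.univ.filter (· ∉ E.states)), add_zero]
    · exact (Finset.sum_subtype _ (by simp) _).symm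
    · intro t ht
      exact E.P_eq_zero (D.act_mem s) (by simpa using ht)
  rw [h, M.sum_P (E.acts_enabled s (D.act_mem s)), ENNReal.ofReal_one]

/-- The distribution of the next state under `D`. -/
def step (s : E.states) : PMF E.states :=
  letI := Fintype.ofFinite E.states
  PMF.ofFintype (fun t => ENNReal.ofReal (M.P s (D.act s) t)) (D.sum_step s)

/-- The probability measure `Pr_{s,D}` on the state sequences of paths of the induced process (the
actions along a path are determined by its states, as `D` is stationary and deterministic). -/
def Pr (s : E.states) : Measure (ℕ → E.states) := chainLaw D.step s

/-- A state is transient if the paths that start in it and never return to it have positive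
probability. -/
def IsTransient (s : E.states) : Prop := 0 < D.Pr s {π | ∀ n, π (n + 1) ≠ s}

/-- A state is recurrent if it is not transient. -/
def IsRecurrent (s : E.states) : Prop := ¬ D.IsTransient s

/-- `t` is accessible from `s` through steps of positive probability. -/
def Accessible (s t : E.states) : Prop :=
  Relation.ReflTransGen (fun u v : E.states => 0 < M.P u (D.act u) v) s t

/-- Recurrent classes: classes of mutually accessible recurrent states. -/
def IsRecurrentClass (C : Set E.states) : Prop :=
  ∃ s, D.IsRecurrent s ∧ C = {t | D.IsRecurrent t ∧ D.Accessible s t ∧ D.Accessible t s}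

/-- The induced process is a unichain: a single recurrent class, plus possibly transient states. -/
def IsUnichain : Prop := ∃! C, D.IsRecurrentClass C

/-- The induced process is a multichain: at least two recurrent classes. -/
def IsMultichain : Prop := ∃ C C', D.IsRecurrentClass C ∧ D.IsRecurrentClass C' ∧ C ≠ C'

/-- The ratio of the costs accumulated during the first `n` steps of a path. -/
def ratio (G : Set S) (π : ℕ → E.states) (n : ℕ) : ℝ :=
  (∑ i ∈ Finset.range n, M.cost₁ G (π i) (D.act (π i))) /
    ∑ j ∈ Finset.range n, M.cost₂ (π j : S) (D.act (π j))

/-- The long-run ratio `ℛ(π)`. -/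
def longRunRatio (G : Set S) (π : ℕ → E.states) : ℝ := limUnder atTop (D.ratio G π)

/-- The long-run ratio is well defined: from every state, the limit defining it exists almost
surely, and it is integrable. -/
def RatioWellDefined (G : Set S) : Prop :=
  ∀ s, (∀ᵐ π ∂(D.Pr s), ∃ r, Tendsto (D.ratio G π) atTop (𝓝 r)) ∧
    Integrable (D.longRunRatio G) (D.Pr s)

/-- The expected long-run ratio `𝔼_{s,D}(ℛ)`. -/
def expRatio (G : Set S) (s : E.states) : ℝ := ∫ π, D.longRunRatio G π ∂(D.Pr s)

end SubMA.Policy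

end

/-! Write `P` for the averaging operator of a finite chain. The range and kernel of `1 - P` are
complementary, so every cost splits as `c = f - P f + h` with `P h = h` (`exists_decomposition`).
Along almost every path the averages of the coboundary `f - P f` tend to 0 (`ae_tendsto_coboundary`)
and the bounded martingale `h (π n)` converges (`ae_tendsto_harmonic`). The long-run ratio is
therefore `lim h₁ (π n) / lim h₂ (π n)`. Non-Zenoness places a Markovian state in every nonempty
closed set, and this makes `h₂` positive (`harmonic_part_pos`). No periodicity or stationary
distribution enters.

Let `m` be the minimum of `h₁ / h₂`. Then `h₁ - m h₂` is harmonic and nonnegative, so its zero set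
is closed and contains an irreducible closed set `C`; every ratio of the chain is at least `m`. As
the end component is strongly connected, the policy can be changed outside `C` so that `C` is
reachable from everywhere (`exists_reaching`). Then `C` is the only recurrent class. On `C` the cost
`c₁ - m c₂` is still a coboundary, and the minimum principle forces its new harmonic part to vanish
everywhere (`harmonic_eq_zero_of_agree`), so the new ratio is almost surely `m`. Maximisation is
minimisation with `c₁` negated. -/

noncomputable section

namespace FiniteChain

/-! ### The law of a Markov chain: cylinders and the Markov property -/

section Law

variable {X : Type*} [MeasurableSpace X] [Countable X] [DiscreteMeasurableSpace X]

/-- The one-step transition kernel, as a function of the whole history up to time `n`. -/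
def historyKernel (p : X → PMF X) (n : ℕ) : Kernel (Finset.Iic n → X) X :=
  (Kernel.ofFunOfCountable fun y => (p y).toMeasure).comap
    (fun h : (Finset.Iic n → X) => h ⟨n, Finset.mem_Iic.mpr le_rfl⟩) (measurable_pi_apply _)

instance (p : X → PMF X) (n : ℕ) : IsMarkovKernel (historyKernel p n) :=
  ⟨fun h => inferInstanceAs
    (IsProbabilityMeasure (p (h ⟨n, Finset.mem_Iic.mpr le_rfl⟩)).toMeasure)⟩

lemma historyKernel_apply (p : X → PMF X) (n : ℕ) (h : Finset.Iic n → X) :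
    historyKernel p n h = (p (h ⟨n, Finset.mem_Iic.mpr le_rfl⟩)).toMeasure := rfl

lemma chainLaw_eq_traj (p : X → PMF X) (x : X) :
    chainLaw p x = Kernel.traj (X := fun _ => X) (historyKernel p) 0 (fun _ => x) := rfl

instance (p : X → PMF X) (x : X) : IsProbabilityMeasure (chainLaw p x) := by
  rw [chainLaw_eq_traj]; infer_instance

lemma chainLaw_map_frestrictLe (p : X → PMF X) (x : X) (n : ℕ) :
    (chainLaw p x).map (Preorder.frestrictLe n) =
      Kernel.partialTraj (X := fun _ => X) (historyKernel p) 0 n (fun _ => x) := by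
  rw [chainLaw_eq_traj, Kernel.traj_map_frestrictLe_apply]

/-- The set of paths that agree with `a` up to time `n`. -/
def cyl (n : ℕ) (a : ℕ → X) : Set (ℕ → X) := {π | ∀ i ≤ n, π i = a i}

omit [Countable X] in
lemma measurableSet_cyl (n : ℕ) (a : ℕ → X) : MeasurableSet (cyl n a) := by
  have : cyl n a = ⋂ i ∈ Finset.Iic n, (fun π : ℕ → X => π i) ⁻¹' {a i} := by
    ext π; simp [cyl]
  rw [this]
  exact Finset.measurableSet_biInter _ fun i _ => measurable_pi_apply i (measurableSet_singleton _)

omit [MeasurableSpace X] [DiscreteMeasurableSpace X] [Countable X] in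
lemma cyl_eq_preimage (n : ℕ) (a : ℕ → X) :
    cyl n a = Preorder.frestrictLe (π := fun _ => X) n ⁻¹'
      {Preorder.frestrictLe (π := fun _ => X) n a} := by
  ext π
  simp [cyl, funext_iff]

lemma chainLaw_cyl_zero [DecidableEq X] (p : X → PMF X) (x : X) (a : ℕ → X) :
    chainLaw p x (cyl 0 a) = if a 0 = x then 1 else 0 := by
  rw [cyl_eq_preimage, ← Measure.map_apply (by fun_prop) (measurableSet_singleton _),
    chainLaw_map_frestrictLe, Kernel.partialTraj_self, Kernel.id_apply,
    Measure.dirac_apply' _ (measurableSet_singleton _)]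
  simp only [Set.indicator_apply, Set.mem_singleton_iff, Pi.one_apply]
  congr 1
  simp [funext_iff, eq_comm]

lemma chainLaw_cyl_succ (p : X → PMF X) (x : X) (n : ℕ) (a : ℕ → X) :
    chainLaw p x (cyl (n + 1) a) = chainLaw p x (cyl n a) * p (a n) (a (n + 1)) := by
  have h2 : cyl (n + 1) a = (fun π : ℕ → X => (Preorder.frestrictLe (π := fun _ => X) n π,
      π (n + 1))) ⁻¹' ({Preorder.frestrictLe (π := fun _ => X) n a} ×ˢ {a (n + 1)}) := by
    ext π
    simp only [cyl, Set.mem_ofPred_eq, Set.mem_preimage, Set.mem_prod, Set.mem_singleton_iff,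
      funext_iff, Preorder.frestrictLe_apply, Subtype.forall, Finset.mem_Iic]
    constructor
    · exact fun h => ⟨fun i hi => h i (by omega), h _ le_rfl⟩
    · rintro ⟨h, h'⟩ i hi
      rcases Nat.le_succ_iff.mp hi with hi | rfl
      · exact h i hi
      · exact h'
  rw [h2, cyl_eq_preimage, ← Measure.map_apply (by fun_prop) (measurableSet_singleton _),
    chainLaw_map_frestrictLe, ← Measure.map_apply (by fun_prop)
      ((measurableSet_singleton _).prod (measurableSet_singleton _)), chainLaw_eq_traj,
    ← Kernel.partialTraj_compProd_eq_map_traj (X := fun _ => X) (κ := historyKernel p)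
      (Nat.zero_le n),
    Measure.compProd_apply_prod (measurableSet_singleton _) (measurableSet_singleton _),
    lintegral_singleton, historyKernel_apply,
    PMF.toMeasure_apply_singleton _ _ (measurableSet_singleton _), mul_comm]
  rfl

lemma ae_chainLaw_zero (p : X → PMF X) (x : X) : ∀ᵐ π ∂(chainLaw p x), π 0 = x := by
  classical
  have h := chainLaw_cyl_zero p x (fun _ => x)
  rw [if_pos rfl] at h
  have h' := (prob_compl_eq_zero_iff (measurableSet_cyl 0 fun _ => x)).mpr h
  rw [ae_iff]
  convert h' using 2
  ext π
  simp [cyl]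

/-- Finite measures on path space that agree on all cylinders are equal. -/
lemma ext_of_cyl {μ ν : Measure (ℕ → X)} [IsFiniteMeasure μ] [IsFiniteMeasure ν]
    (h : ∀ n a, μ (cyl n a) = ν (cyl n a)) : μ = ν := by
  have hn : ∀ n, μ.map (Preorder.frestrictLe (π := fun _ => X) n) =
      ν.map (Preorder.frestrictLe (π := fun _ => X) n) := by
    intro n
    refine Measure.ext_of_singleton fun g => ?_
    -- Values after time `n` are irrelevant; `g` at time 0 serves as filler, since `X` is not
    -- assumed inhabited.
    obtain ⟨a, rfl⟩ : ∃ a : ℕ → X, Preorder.frestrictLe (π := fun _ => X) n a = g :=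
      ⟨fun i => if hi : i ≤ n then g ⟨i, Finset.mem_Iic.mpr hi⟩
        else g ⟨0, Finset.mem_Iic.mpr (Nat.zero_le n)⟩, by
        ext ⟨i, hi⟩
        simp [Finset.mem_Iic.mp hi]⟩
    rw [Measure.map_apply (by fun_prop) (measurableSet_singleton _),
      Measure.map_apply (by fun_prop) (measurableSet_singleton _), ← cyl_eq_preimage, h]
  -- Every finite set of times lies in an initial segment, so the laws of the initial segments fix
  -- all finite marginals.
  refine IsProjectiveLimit.unique (P := fun I => ν.map I.restrict) (fun I => ?_) fun I => rfl
  have hI : I ⊆ Finset.Iic (I.sup id) := fun i hi =>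
    Finset.mem_Iic.mpr (Finset.le_sup (f := id) hi)
  have hc : (I.restrict : (ℕ → X) → _) = Finset.restrict₂ (π := fun _ => X) hI ∘
      Preorder.frestrictLe (π := fun _ => X) (I.sup id) := rfl
  change μ.map I.restrict = ν.map I.restrict
  rw [hc, ← Measure.map_map (by fun_prop) (by fun_prop),
    ← Measure.map_map (by fun_prop) (by fun_prop), hn]

/-- Almost every path starts in `x`, so up to a null set the event is the cylinder of `a` with `x`
prepended. -/
lemma chainLaw_shift_cyl (p : X → PMF X) (x : X) (n : ℕ) (a : ℕ → X) :
    chainLaw p x {π | (fun n => π (n + 1)) ∈ cyl n a} = p x (a 0) * chainLaw p (a 0) (cyl n a) := by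
  classical
  obtain ⟨b, hb0, hb⟩ : ∃ b : ℕ → X, b 0 = x ∧ ∀ n, b (n + 1) = a n :=
    ⟨fun n => Nat.casesOn n x a, rfl, fun _ => rfl⟩
  have h1 : chainLaw p x {π | (fun n => π (n + 1)) ∈ cyl n a} = chainLaw p x (cyl (n + 1) b) := by
    refine measure_congr ?_
    filter_upwards [ae_chainLaw_zero p x] with π hπ
    refine propext ⟨fun h i hi => ?_, fun h i hi => ?_⟩
    · rcases i with _ | i
      · rw [hb0, hπ]
      · rw [hb]
        exact h i (by omega)
    · rw [← hb]
      exact h (i + 1) (by omega)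
  rw [h1]
  clear h1
  induction n with
  | zero => rw [chainLaw_cyl_succ, chainLaw_cyl_zero, chainLaw_cyl_zero, if_pos hb0, if_pos rfl,
      hb, hb0, one_mul, mul_one]
  | succ n ih => rw [chainLaw_cyl_succ, ih, chainLaw_cyl_succ p (a 0), hb, hb, mul_assoc]

/-- The Markov property at time one, for measures. -/
lemma chainLaw_map_shift (p : X → PMF X) (x : X) :
    (chainLaw p x).map (fun π n => π (n + 1)) = Measure.sum fun y => p x y • chainLaw p y := by
  have hm : Measurable fun (π : ℕ → X) n => π (n + 1) := by fun_prop
  have hfin : IsFiniteMeasure (Measure.sum fun y => p x y • chainLaw p y) := by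
    refine ⟨?_⟩
    simp [Measure.sum_apply, PMF.tsum_coe]
  have hfin' : IsFiniteMeasure ((chainLaw p x).map (fun π n => π (n + 1))) :=
    Measure.isFiniteMeasure_map _ _
  refine ext_of_cyl fun n a => ?_
  rw [Measure.map_apply hm (measurableSet_cyl n a)]
  refine (chainLaw_shift_cyl p x n a).trans ?_
  -- Only `y = a 0` contributes: the chain started elsewhere misses the cylinder at time 0.
  rw [Measure.sum_apply _ (measurableSet_cyl n a), tsum_eq_single (a 0)]
  · simp
  · intro y hy
    have h0 : chainLaw p y (cyl n a) = 0 := by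
      refine measure_mono_null (t := {π | ¬ π 0 = y}) (fun π hπ h => ?_)
        (ae_iff.mp (ae_chainLaw_zero p y))
      exact hy (h.symm.trans (hπ 0 (Nat.zero_le n)))
    simp [h0]

/-- The Markov property at time one. -/
lemma chainLaw_shift (p : X → PMF X) (x : X) {B : Set (ℕ → X)} (hB : MeasurableSet B) :
    chainLaw p x {π | (fun n => π (n + 1)) ∈ B} = ∑' y, p x y * chainLaw p y B := by
  have h := congrArg (fun μ => μ B) (chainLaw_map_shift p x)
  simp only [Measure.map_apply (f := fun (π : ℕ → X) n => π (n + 1)) (by fun_prop) hB,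
    Measure.sum_apply _ hB] at h
  exact h

end Law

/-! ### One-step conditional expectations -/

section CondExp

variable {X : Type*} [MeasurableSpace X] [Fintype X] [DiscreteMeasurableSpace X]

/-- The averaging operator of the chain. -/
def avg (p : X → PMF X) : (X → ℝ) →ₗ[ℝ] (X → ℝ) where
  toFun f x := ∑ y, (p x y).toReal * f y
  map_add' f g := by ext x; simp [mul_add, Finset.sum_add_distrib]
  map_smul' c f := by ext x; simp [Finset.mul_sum, mul_left_comm]

omit [MeasurableSpace X] [DiscreteMeasurableSpace X] in
lemma avg_apply (p : X → PMF X) (f : X → ℝ) (x : X) : avg p f x = ∑ y, (p x y).toReal * f y := rfl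

lemma integrable_of_bdd {p : X → PMF X} {x : X} {Z : (ℕ → X) → ℝ} (hZ : Measurable Z) {C : ℝ}
    (hC : ∀ π, |Z π| ≤ C) : Integrable Z (chainLaw p x) :=
  Integrable.of_bound hZ.aestronglyMeasurable C (ae_of_all _ hC)

omit [DiscreteMeasurableSpace X] [MeasurableSpace X] in
lemma exists_bdd (f : X → ℝ) : ∃ C, 0 ≤ C ∧ ∀ x, |f x| ≤ C := by
  obtain ⟨C, hC⟩ := (Set.finite_range fun x => |f x|).bddAbove
  exact ⟨max C 0, le_max_right _ _, fun x => (hC ⟨x, rfl⟩).trans (le_max_left _ _)⟩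

lemma integrable_coord (p : X → PMF X) (x : X) (f : X → ℝ) (n : ℕ) :
    Integrable (fun π => f (π n)) (chainLaw p x) := by
  obtain ⟨C, -, hC⟩ := exists_bdd f
  exact integrable_of_bdd ((measurable_of_finite f).comp (measurable_pi_apply n))
    fun π => hC _

lemma condExp_chainLaw (p : X → PMF X) (x : X) (f : X → ℝ) (n : ℕ) :
    (chainLaw p x)[fun π => f (π (n + 1)) | Filtration.piLE (X := fun _ : ℕ => X) n]
      =ᵐ[chainLaw p x] fun π => avg p f (π n) := by
  have h := Kernel.condExp_traj (X := fun _ => X) (κ := historyKernel p) (Nat.zero_le n)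
    (x₀ := fun _ => x) (integrable_coord p x f (n + 1))
  rw [chainLaw_eq_traj]
  refine h.trans (Eventually.of_forall fun π => ?_)
  have h2 : ∀ g : Finset.Iic n → X, ∫ y, f (y (n + 1)) ∂(Kernel.traj (X := fun _ => X)
      (historyKernel p) n g) = ∫ y, f y ∂(historyKernel p n g) := by
    intro g
    rw [← Kernel.map_traj_succ_self (X := fun _ => X) (κ := historyKernel p),
      Kernel.map_apply _ (by fun_prop), integral_map (measurable_pi_apply _).aemeasurable]
    exact (measurable_of_finite f).aestronglyMeasurable
  simp only [h2, historyKernel_apply]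
  rw [PMF.integral_eq_sum]
  simp [avg_apply]

end CondExp

end FiniteChain

namespace FiniteChain

/-! ### Martingale convergence and the strong law for coboundaries -/

section Martingale

variable {X : Type*} [MeasurableSpace X] [Fintype X] [DiscreteMeasurableSpace X]

/-- The canonical filtration on path space. -/
abbrev pathFiltration (X : Type*) [MeasurableSpace X] :
    Filtration ℕ (MeasurableSpace.pi : MeasurableSpace (ℕ → X)) :=
  Filtration.piLE (X := fun _ : ℕ => X)

lemma stronglyMeasurable_coord (f : X → ℝ) {i n : ℕ} (h : i ≤ n) :
    StronglyMeasurable[pathFiltration X n] fun π : ℕ → X => f (π i) := by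
  refine Measurable.stronglyMeasurable ((measurable_of_finite f).comp ?_)
  have h1 : Measurable[pathFiltration X n] (Preorder.restrictLe (π := fun _ : ℕ => X) n) :=
    comap_measurable _
  exact (measurable_pi_apply (⟨i, h⟩ : Set.Iic n)).comp h1

/-- A harmonic function along the chain is a bounded martingale. -/
lemma ae_tendsto_harmonic {p : X → PMF X} {h : X → ℝ} (hh : avg p h = h) (x : X) :
    ∀ᵐ π ∂(chainLaw p x), ∃ c, Tendsto (fun n => h (π n)) atTop (𝓝 c) := by
  have hm : Martingale (fun n π => h (π n)) (pathFiltration X) (chainLaw p x) := by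
    refine martingale_nat (fun n => stronglyMeasurable_coord h le_rfl)
      (fun n => integrable_coord p x h n) fun n => ?_
    have := condExp_chainLaw p x h n
    rw [hh] at this
    exact this.symm
  obtain ⟨C, hC0, hC⟩ := exists_bdd h
  refine hm.submartingale.exists_ae_tendsto_of_bdd (R := C.toNNReal) fun n => ?_
  refine (eLpNorm_le_of_ae_bound (C := C) (ae_of_all _ fun π => hC _)).trans ?_
  simp

/-- The innovation `f(Xₙ₊₁) - 𝔼[f(Xₙ₊₁) | Xₙ]`. -/
def innov (p : X → PMF X) (f : X → ℝ) (n : ℕ) (π : ℕ → X) : ℝ := f (π (n + 1)) - avg p f (π n)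

omit [MeasurableSpace X] [DiscreteMeasurableSpace X] in
lemma exists_abs_innov_le (p : X → PMF X) (f : X → ℝ) :
    ∃ C, 0 ≤ C ∧ ∀ n π, |innov p f n π| ≤ C := by
  obtain ⟨C, hC0, hC⟩ := exists_bdd f
  obtain ⟨C', hC0', hC'⟩ := exists_bdd (avg p f)
  exact ⟨C + C', by positivity, fun n π => (abs_sub _ _).trans (add_le_add (hC _) (hC' _))⟩

lemma measurable_innov (p : X → PMF X) (f : X → ℝ) (n : ℕ) : Measurable (innov p f n) :=
  ((measurable_of_finite f).comp (measurable_pi_apply _)).sub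
    ((measurable_of_finite (avg p f)).comp (measurable_pi_apply _))

lemma memLp_innov (p : X → PMF X) (f : X → ℝ) (x : X) (n : ℕ) :
    MemLp (innov p f n) 2 (chainLaw p x) := by
  obtain ⟨C, -, hC⟩ := exists_abs_innov_le p f
  exact MemLp.of_bound (measurable_innov p f n).aestronglyMeasurable C (ae_of_all _ (hC n))

lemma condExp_innov (p : X → PMF X) (f : X → ℝ) (x : X) (n : ℕ) :
    (chainLaw p x)[innov p f n | pathFiltration X n] =ᵐ[chainLaw p x] 0 := by
  have h1 := condExp_chainLaw p x f n
  have h2 : (chainLaw p x)[fun π => avg p f (π n) | pathFiltration X n] =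
      fun π => avg p f (π n) :=
    condExp_of_stronglyMeasurable ((pathFiltration X).le n)
      (stronglyMeasurable_coord (avg p f) le_rfl) (integrable_coord p x (avg p f) n)
  have h3 := condExp_sub (integrable_coord p x f (n + 1)) (integrable_coord p x (avg p f) n)
    (pathFiltration X n)
  change (chainLaw p x)[innov p f n | pathFiltration X n] =ᵐ[chainLaw p x] _ at h3
  filter_upwards [h1, h3] with π e1 e3
  rw [e3, Pi.sub_apply, h2, e1]
  simp

/-- The martingale `∑ Yᵢ / (i + 1)` of weighted innovations. -/
def weighted (p : X → PMF X) (f : X → ℝ) (n : ℕ) (π : ℕ → X) : ℝ :=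
  ∑ i ∈ Finset.range n, ((i : ℝ) + 1)⁻¹ * innov p f i π

lemma memLp_weighted (p : X → PMF X) (f : X → ℝ) (x : X) (n : ℕ) :
    MemLp (weighted p f n) 2 (chainLaw p x) :=
  memLp_finsetSum _ fun i _ => (memLp_innov p f x i).const_mul _

lemma stronglyMeasurable_weighted (p : X → PMF X) (f : X → ℝ) (n : ℕ) :
    StronglyMeasurable[pathFiltration X n] (weighted p f n) := by
  refine Finset.stronglyMeasurable_fun_sum _ fun i hi => ?_
  have hi := Finset.mem_range.mp hi
  exact StronglyMeasurable.const_mul ((stronglyMeasurable_coord f (by omega)).sub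
    (stronglyMeasurable_coord (avg p f) (by omega))) _

omit [MeasurableSpace X] [DiscreteMeasurableSpace X] in
lemma weighted_succ (p : X → PMF X) (f : X → ℝ) (n : ℕ) :
    weighted p f (n + 1) = weighted p f n + fun π => ((n : ℝ) + 1)⁻¹ * innov p f n π := by
  ext π
  simp [weighted, Finset.sum_range_succ]

lemma martingale_weighted (p : X → PMF X) (f : X → ℝ) (x : X) :
    Martingale (weighted p f) (pathFiltration X) (chainLaw p x) := by
  refine martingale_nat (stronglyMeasurable_weighted p f)
    (fun n => (memLp_weighted p f x n).integrable one_le_two) fun n => ?_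
  rw [weighted_succ]
  have h1 := condExp_add ((memLp_weighted p f x n).integrable one_le_two)
    (((memLp_innov p f x n).const_mul ((n : ℝ) + 1)⁻¹).integrable one_le_two) (pathFiltration X n)
  have h2 := condExp_smul (μ := chainLaw p x) ((n : ℝ) + 1)⁻¹ (innov p f n) (pathFiltration X n)
  have h3 : (chainLaw p x)[weighted p f n | pathFiltration X n] = weighted p f n :=
    condExp_of_stronglyMeasurable ((pathFiltration X).le n)
      (stronglyMeasurable_weighted p f n) ((memLp_weighted p f x n).integrable one_le_two)
  filter_upwards [h1, h2, condExp_innov p f x n] with π e1 e2 e3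
  rw [e1, Pi.add_apply, h3]
  change _ = _ + ((chainLaw p x)[((n : ℝ) + 1)⁻¹ • innov p f n | pathFiltration X n]) π
  rw [e2]
  simp [e3]

/-- Orthogonality of martingale increments: the first factor is known at time `n`, and the second
has conditional mean zero. -/
lemma integral_weighted_mul_innov (p : X → PMF X) (f : X → ℝ) (x : X) (n : ℕ) :
    ∫ π, weighted p f n π * innov p f n π ∂(chainLaw p x) = 0 := by
  have hi : Integrable (weighted p f n * innov p f n) (chainLaw p x) :=
    (memLp_weighted p f x n).integrable_mul (memLp_innov p f x n)
  have h := condExp_mul_of_stronglyMeasurable_left (stronglyMeasurable_weighted p f n) hi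
    ((memLp_innov p f x n).integrable one_le_two)
  change ∫ π, (weighted p f n * innov p f n) π ∂(chainLaw p x) = 0
  rw [← integral_condExp ((pathFiltration X).le n)]
  refine integral_eq_zero_of_ae ?_
  filter_upwards [h, condExp_innov p f x n] with π e1 e2
  rw [e1, Pi.mul_apply, e2]
  simp

lemma integral_weighted_sq_le (p : X → PMF X) (f : X → ℝ) (x : X) {C : ℝ}
    (hC : ∀ n π, |innov p f n π| ≤ C) (n : ℕ) :
    ∫ π, weighted p f n π ^ 2 ∂(chainLaw p x) ≤
      ∑ i ∈ Finset.range n, C ^ 2 * (((i : ℝ) + 1)⁻¹) ^ 2 := by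
  induction n with
  | zero => simp [weighted]
  | succ n ih =>
    have i1 : Integrable (fun π => weighted p f n π ^ 2) (chainLaw p x) :=
      (memLp_weighted p f x n).integrable_sq
    have i2 : Integrable (fun π => weighted p f n π * innov p f n π) (chainLaw p x) :=
      (memLp_weighted p f x n).integrable_mul (memLp_innov p f x n)
    have i3 : Integrable (fun π => innov p f n π ^ 2) (chainLaw p x) :=
      (memLp_innov p f x n).integrable_sq
    have e : ∀ π, weighted p f (n + 1) π ^ 2 = weighted p f n π ^ 2 +
        2 * ((n : ℝ) + 1)⁻¹ * (weighted p f n π * innov p f n π) +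
        (((n : ℝ) + 1)⁻¹) ^ 2 * innov p f n π ^ 2 := by
      intro π
      rw [weighted_succ, Pi.add_apply]
      ring
    have h3 : ∫ π, innov p f n π ^ 2 ∂(chainLaw p x) ≤ C ^ 2 := by
      have := integral_mono (μ := chainLaw p x) i3 (integrable_const (C ^ 2)) fun π => by
        have := hC n π
        rw [← sq_abs]
        gcongr
      simpa using this
    simp_rw [e]
    have i12 : Integrable (fun π => weighted p f n π ^ 2 +
        2 * ((n : ℝ) + 1)⁻¹ * (weighted p f n π * innov p f n π)) (chainLaw p x) :=
      i1.add (i2.const_mul _)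
    rw [integral_add i12 (i3.const_mul _), integral_add i1 (i2.const_mul _), integral_const_mul,
      integral_const_mul, integral_weighted_mul_innov, Finset.sum_range_succ,
      mul_zero, add_zero, mul_comm (C ^ 2)]
    gcongr

/-- The weights `1 / (i + 1)` are square summable, so the martingale is bounded in L², hence in L¹
by `|w| ≤ 1 + w²`, and Doob's theorem applies. -/
lemma ae_tendsto_weighted (p : X → PMF X) (f : X → ℝ) (x : X) :
    ∀ᵐ π ∂(chainLaw p x), ∃ c, Tendsto (fun n => weighted p f n π) atTop (𝓝 c) := by
  obtain ⟨C, -, hC⟩ := exists_abs_innov_le p f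
  have hs : Summable fun i : ℕ => C ^ 2 * (((i : ℝ) + 1)⁻¹) ^ 2 := by
    refine Summable.mul_left _ ?_
    have := (summable_nat_add_iff 1).mpr (Real.summable_nat_pow_inv.mpr one_lt_two)
    simpa using this
  set T := ∑' i : ℕ, C ^ 2 * (((i : ℝ) + 1)⁻¹) ^ 2
  refine (martingale_weighted p f x).submartingale.exists_ae_tendsto_of_bdd
    (R := (1 + T).toNNReal) fun n => ?_
  have hi := (memLp_weighted p f x n).integrable one_le_two
  rw [eLpNorm_one_eq_lintegral_enorm, ← ofReal_integral_norm_eq_lintegral_enorm hi]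
  refine ENNReal.ofReal_le_ofReal ?_
  calc ∫ π, ‖weighted p f n π‖ ∂(chainLaw p x)
      ≤ ∫ π, (1 + weighted p f n π ^ 2) ∂(chainLaw p x) := by
        refine integral_mono hi.norm ((integrable_const 1).add
          (memLp_weighted p f x n).integrable_sq) fun π => ?_
        simp only [Real.norm_eq_abs]
        rw [← sq_abs]
        nlinarith [sq_nonneg (|weighted p f n π| - 1)]
    _ = 1 + ∫ π, weighted p f n π ^ 2 ∂(chainLaw p x) := by
        rw [integral_add (integrable_const 1) (memLp_weighted p f x n).integrable_sq]
        simp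
    _ ≤ 1 + T := by
        gcongr
        exact (integral_weighted_sq_le p f x hC n).trans
          (hs.sum_le_tsum _ fun i _ => by positivity)

omit [MeasurableSpace X] [DiscreteMeasurableSpace X] in
/-- Summation by parts for the weights `1 / (i + 1)`. -/
lemma sum_innov_eq (p : X → PMF X) (f : X → ℝ) (π : ℕ → X) (n : ℕ) :
    ∑ i ∈ Finset.range n, innov p f i π =
      n * weighted p f n π - ∑ i ∈ Finset.range n, weighted p f i π := by
  induction n with
  | zero => simp
  | succ n ih =>
    have : weighted p f (n + 1) π = weighted p f n π + ((n : ℝ) + 1)⁻¹ * innov p f n π := by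
      simp [weighted, Finset.sum_range_succ]
    have hn : ((n : ℝ) + 1) ≠ 0 := by positivity
    rw [Finset.sum_range_succ, Finset.sum_range_succ, ih, this]
    push_cast
    field_simp
    ring

/-- The strong law of large numbers for coboundaries. -/
lemma ae_tendsto_coboundary (p : X → PMF X) (f : X → ℝ) (x : X) :
    ∀ᵐ π ∂(chainLaw p x), Tendsto
      (fun n : ℕ => (n : ℝ)⁻¹ * ∑ i ∈ Finset.range n, (f (π i) - avg p f (π i))) atTop (𝓝 0) := by
  obtain ⟨C, -, hC⟩ := exists_bdd f
  filter_upwards [ae_tendsto_weighted p f x] with π ⟨c, hc⟩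
  -- The coboundary differs from the innovation by `f (π i) - f (π (i + 1))`, which telescopes to a
  -- bounded term.
  have e : ∀ n : ℕ, ∑ i ∈ Finset.range n, (f (π i) - avg p f (π i)) =
      ∑ i ∈ Finset.range n, innov p f i π + (f (π 0) - f (π n)) := by
    intro n
    rw [← Finset.sum_range_sub' (fun i => f (π i)), ← Finset.sum_add_distrib]
    refine Finset.sum_congr rfl fun i _ => ?_
    rw [innov]
    ring
  have h0 : Tendsto (fun n : ℕ => (n : ℝ)⁻¹ * (f (π 0) - f (π n))) atTop (𝓝 0) := by
    refine squeeze_zero_norm (a := fun n : ℕ => (n : ℝ)⁻¹ * (2 * C)) (fun n => ?_) ?_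
    · rw [norm_mul, Real.norm_of_nonneg (by positivity : (0:ℝ) ≤ (n : ℝ)⁻¹), Real.norm_eq_abs]
      gcongr
      exact (abs_sub _ _).trans (by linarith [hC (π 0), hC (π n)])
    · simpa using (tendsto_inv_atTop_nhds_zero_nat (𝕜 := ℝ)).mul_const (2 * C)
  -- Kronecker's lemma: the averaged innovations are `weighted` minus its Cesàro means, and both
  -- tend to `c`.
  have h1 := (hc.sub hc.cesaro).add h0
  rw [sub_self, add_zero] at h1
  refine h1.congr' ?_
  filter_upwards [eventually_gt_atTop 0] with n hn
  have hn' : (n : ℝ) ≠ 0 := by positivity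
  rw [e, sum_innov_eq]
  field_simp

end Martingale

end FiniteChain

namespace FiniteChain

/-! ### Closed sets, coboundaries and harmonic functions -/

section Potential

variable {X : Type*}

/-- The one-step reachability relation. -/
def Step (p : X → PMF X) (x y : X) : Prop := 0 < p x y

/-- Sets of states that the chain cannot leave. -/
def Closed (p : X → PMF X) (W : Set X) : Prop := ∀ x ∈ W, ∀ y, Step p x y → y ∈ W

lemma Closed.mem_of_reflTransGen {p : X → PMF X} {W : Set X} (hW : Closed p W) {x y : X}
    (hx : x ∈ W) (h : Relation.ReflTransGen (Step p) x y) : y ∈ W := by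
  induction h with
  | refl => exact hx
  | tail _ h ih => exact hW _ ih _ h

/-- From every point of a finite directed graph one can reach a point of a bottom strongly connected
component. -/
lemma exists_bottom [Finite X] (r : X → X → Prop) (x : X) :
    ∃ y, Relation.ReflTransGen r x y ∧
      ∀ z, Relation.ReflTransGen r y z → Relation.ReflTransGen r z y := by
  -- A reachable point whose own reachable set is smallest: no successor of it can lose any point of
  -- that set.
  obtain ⟨y, hy, hmin⟩ := Set.exists_min_image {y | Relation.ReflTransGen r x y}
    (fun y => Set.ncard {z | Relation.ReflTransGen r y z}) (Set.toFinite _) ⟨x, .refl⟩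
  refine ⟨y, hy, fun z hz => ?_⟩
  have hsub : {w | Relation.ReflTransGen r z w} ⊆ {w | Relation.ReflTransGen r y w} :=
    fun w hw => hz.trans hw
  have heq := Set.eq_of_subset_of_ncard_le hsub (hmin z (hy.trans hz)) (Set.toFinite _)
  exact heq.ge (Relation.ReflTransGen.refl : Relation.ReflTransGen r y y)

/-- A nonempty closed set contains a nonempty closed, strongly connected set. -/
lemma Closed.exists_irreducible [Finite X] {p : X → PMF X} {W : Set X} (hW : Closed p W)
    (hne : W.Nonempty) : ∃ C ⊆ W, C.Nonempty ∧ Closed p C ∧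
      ∀ x ∈ C, ∀ y ∈ C, Relation.ReflTransGen (Step p) x y := by
  obtain ⟨x, hx⟩ := hne
  obtain ⟨y, hxy, hy⟩ := exists_bottom (Step p) x
  exact ⟨{z | Relation.ReflTransGen (Step p) y z},
    fun z hz => hW.mem_of_reflTransGen hx (hxy.trans hz), ⟨y, .refl⟩,
    fun z hz w hw => Relation.ReflTransGen.tail hz hw, fun z hz w hw => (hy z hz).trans hw⟩

variable [Fintype X] {p : X → PMF X}

lemma sum_toReal (p : X → PMF X) (x : X) : ∑ y, (p x y).toReal = 1 := by
  rw [← ENNReal.toReal_sum fun a _ => PMF.apply_ne_top _ a,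
    ← tsum_fintype (L := .unconditional X), PMF.tsum_coe]
  rfl

lemma le_avg {f : X → ℝ} {x : X} {c : ℝ} (h : ∀ y, Step p x y → c ≤ f y) : c ≤ avg p f x := by
  rw [avg_apply, ← one_mul c, ← sum_toReal p x, Finset.sum_mul]
  refine Finset.sum_le_sum fun y _ => ?_
  by_cases hy : Step p x y
  · exact mul_le_mul_of_nonneg_left (h y hy) ENNReal.toReal_nonneg
  · have : p x y = 0 := by simpa [Step] using hy
    simp [this]

lemma eq_of_avg_le {f : X → ℝ} {x : X} {c : ℝ} (h : ∀ y, Step p x y → c ≤ f y)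
    (h' : avg p f x ≤ c) (y : X) (hy : Step p x y) : f y = c := by
  have h0 : ∑ y, (p x y).toReal * (f y - c) = 0 := by
    have := le_antisymm h' (le_avg h)
    simp_rw [mul_sub, Finset.sum_sub_distrib, ← Finset.sum_mul, sum_toReal, one_mul]
    rw [← avg_apply, this, sub_self]
  have h1 := (Finset.sum_eq_zero_iff_of_nonneg fun z _ => ?_).mp h0 y (Finset.mem_univ y)
  · have : (p x y).toReal ≠ 0 := (ENNReal.toReal_pos hy.ne' (PMF.apply_ne_top _ _)).ne'
    have := (mul_eq_zero.mp h1).resolve_left this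
    linarith
  · by_cases hz : Step p x z
    · exact mul_nonneg ENNReal.toReal_nonneg (by linarith [h z hz])
    · have : p x z = 0 := by simpa [Step] using hz
      simp [this]

/-- Minimum principle: an average attains a lower bound of its terms only if all terms of positive
weight do. -/
lemma closed_argmin {h : X → ℝ} (hh : avg p h = h) {m : ℝ} (hm : ∀ x, m ≤ h x) :
    Closed p {x | h x = m} := fun x hx y hy =>
  eq_of_avg_le (fun y _ => hm y) ((congrFun hh x).trans hx).le y hy

/-- At a minimum of `f` on `W` the average of `f` is at least `f`, since the chain stays in `W`. -/
lemma Closed.nonpos_of_coboundary {W : Set X} (hW : Closed p W) (hne : W.Nonempty) {f : X → ℝ}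
    {c : ℝ} (h : ∀ x ∈ W, f x - avg p f x = c) : c ≤ 0 := by
  obtain ⟨x, hx, hmin⟩ := Set.exists_min_image W f (Set.toFinite _) hne
  have := le_avg (p := p) (x := x) fun y hy => hmin y (hW x hx y hy)
  linarith [h x hx]

/-- A coboundary that is constant on a closed set vanishes there. -/
lemma Closed.eq_zero_of_coboundary {W : Set X} (hW : Closed p W) (hne : W.Nonempty) {f : X → ℝ}
    {c : ℝ} (h : ∀ x ∈ W, f x - avg p f x = c) : c = 0 := by
  refine le_antisymm (hW.nonpos_of_coboundary hne h) ?_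
  have := hW.nonpos_of_coboundary (f := -f) (c := -c) hne fun x hx => by
    rw [map_neg, Pi.neg_apply, Pi.neg_apply]
    linarith [h x hx]
  linarith

/-- On the closed set where `h` is minimal the coboundary is constant, so this minimum is 0. -/
lemma harmonic_coboundary_nonneg {f h : X → ℝ} (hh : avg p h = h)
    (hf : ∀ x, h x = f x - avg p f x) (x : X) : 0 ≤ h x := by
  obtain ⟨x₀, -, hmin⟩ := Set.exists_min_image Set.univ h (Set.toFinite _) ⟨x, trivial⟩
  have := (closed_argmin hh fun y => hmin y trivial).eq_zero_of_coboundary ⟨x₀, rfl⟩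
    fun y hy => (hf y).symm.trans hy
  linarith [hmin x trivial]

/-- Every function is the sum of a coboundary and a harmonic function. -/
lemma exists_decomposition (p : X → PMF X) (g : X → ℝ) :
    ∃ f h : X → ℝ, avg p h = h ∧ ∀ x, g x = f x - avg p f x + h x := by
  set T : (X → ℝ) →ₗ[ℝ] (X → ℝ) := LinearMap.id - avg p with hT
  -- A harmonic coboundary and its negative are both nonnegative, so it is 0; rank-nullity then
  -- makes range and kernel span.
  have hdisj : Disjoint (LinearMap.range T) (LinearMap.ker T) := by
    rw [Submodule.disjoint_def]
    rintro h ⟨f, rfl⟩ hk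
    have hh : avg p (T f) = T f := by
      have : T f - avg p (T f) = 0 := hk
      exact (sub_eq_zero.mp this).symm
    ext x
    refine le_antisymm ?_ (harmonic_coboundary_nonneg hh (fun y => rfl) x)
    have := harmonic_coboundary_nonneg (p := p) (f := -f) (h := -T f) (by rw [map_neg, hh])
      (fun y => by simp [hT]; ring) x
    simpa using this
  have htop : LinearMap.range T ⊔ LinearMap.ker T = ⊤ :=
    Submodule.eq_top_of_disjoint _ _ (by rw [LinearMap.finrank_range_add_finrank_ker]) hdisj
  obtain ⟨a, ⟨f, rfl⟩, h, hk, rfl⟩ := Submodule.mem_sup.mp (htop ▸ Submodule.mem_top (x := g))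
  refine ⟨f, h, ?_, fun x => rfl⟩
  have : h - avg p h = 0 := hk
  exact (sub_eq_zero.mp this).symm

/-- The harmonic part of a nonnegative cost is positive if the cost vanishes on no closed set. -/
lemma harmonic_part_pos {c f h : X → ℝ} (hc : ∀ x, 0 ≤ c x)
    (hclosed : ∀ W, Closed p W → W.Nonempty → ∃ x ∈ W, c x ≠ 0) (hh : avg p h = h)
    (hdec : ∀ x, c x = f x - avg p f x + h x) (x : X) : 0 < h x := by
  obtain ⟨x₀, -, hmin⟩ := Set.exists_min_image Set.univ h (Set.toFinite _) ⟨x, trivial⟩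
  have hW := closed_argmin hh fun y => hmin y trivial
  obtain ⟨x₁, hx₁, hmin₁⟩ := Set.exists_min_image {y | h y = h x₀} f (Set.toFinite _) ⟨x₀, rfl⟩
  refine lt_of_lt_of_le ?_ (hmin x trivial)
  -- Suppose `min h ≤ 0`. Where `h` is minimal, `c ≥ 0` gives `avg p f ≤ f`, so the points of least
  -- `f` among these form a closed set. There `f ≤ avg p f` gives `c ≤ 0`: the cost vanishes on a
  -- closed set.
  by_contra! hneg
  have hle : ∀ y, h y = h x₀ → f y = f x₁ → f y ≤ avg p f y := fun y hy hy' =>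
    le_avg fun z hz => hy' ▸ hmin₁ z (hW y hy z hz)
  obtain ⟨y, ⟨hy, hy'⟩, hne⟩ := hclosed {y | h y = h x₀ ∧ f y = f x₁} (fun y ⟨hy, hy'⟩ z hz =>
    ⟨hW y hy z hz, eq_of_avg_le (fun w hw => hmin₁ w (hW y hy w hw))
      (by linarith [hc y, hdec y]) z hz⟩) ⟨x₁, hx₁, rfl⟩
  exact hne (le_antisymm (by linarith [hdec y, hle y hy hy']) (hc y))

end Potential

/-! ### Long-run ratios and the optimal irreducible class -/

section Ratio

variable {X : Type*} [Fintype X]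

/-- The ratio of the costs accumulated during the first `n` steps. -/
def costRatio (c₁ c₂ : X → ℝ) (π : ℕ → X) (n : ℕ) : ℝ :=
  (∑ i ∈ Finset.range n, c₁ (π i)) / ∑ i ∈ Finset.range n, c₂ (π i)

omit [Fintype X] in
lemma costRatio_const_mul (a : ℝ) (c₁ c₂ : X → ℝ) (π : ℕ → X) (n : ℕ) :
    costRatio (fun x => a * c₁ x) c₂ π n = a * costRatio c₁ c₂ π n := by
  rw [costRatio, costRatio, ← Finset.mul_sum, mul_div_assoc]

/-- A cost for which no closed set of states is free. -/
def Proper (p : X → PMF X) (c : X → ℝ) : Prop :=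
  (∀ x, 0 ≤ c x) ∧ ∀ W, Closed p W → W.Nonempty → ∃ x ∈ W, c x ≠ 0

omit [Fintype X] in
/-- If every state reaches `C`, so do nonempty closed sets. -/
lemma Closed.inter_nonempty {p : X → PMF X} {W C : Set X} (hW : Closed p W) (hne : W.Nonempty)
    (hreach : ∀ x, ∃ y ∈ C, Relation.ReflTransGen (Step p) x y) : (W ∩ C).Nonempty := by
  obtain ⟨x, hx⟩ := hne
  obtain ⟨y, hy, hxy⟩ := hreach x
  exact ⟨y, hW.mem_of_reflTransGen hx hxy, hy⟩

/-- The set where `k` is minimal is closed for `p'`, so it meets `C`. The intersection is closed for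
`p`, and on it the minimum of `k` equals the coboundary of `f - f'`, hence is 0. -/
lemma harmonic_nonneg_of_agree {p p' : X → PMF X} {C : Set X} (hC : Closed p C)
    (hp : ∀ x ∈ C, p' x = p x) (hreach : ∀ x, ∃ y ∈ C, Relation.ReflTransGen (Step p') x y)
    {f f' k : X → ℝ} (hk : avg p' k = k)
    (hdec : ∀ x ∈ C, f x - avg p f x = f' x - avg p' f' x + k x) (x : X) : 0 ≤ k x := by
  obtain ⟨x₀, -, hmin⟩ := Set.exists_min_image Set.univ k (Set.toFinite _) ⟨x, trivial⟩
  have hW := closed_argmin hk fun y => hmin y trivial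
  have hWC : Closed p ({y | k y = k x₀} ∩ C) := fun y hy z hz =>
    ⟨hW y hy.1 z (by rw [Step, hp y hy.2]; exact hz), hC y hy.2 z hz⟩
  have := hWC.eq_zero_of_coboundary (f := f - f') (c := k x₀)
    (hW.inter_nonempty ⟨x₀, rfl⟩ hreach) fun y hy => by
      have e : avg p f' y = avg p' f' y := by rw [avg_apply, avg_apply, hp y hy.2]
      have hy1 : k y = k x₀ := hy.1
      rw [map_sub, Pi.sub_apply, Pi.sub_apply, e, ← hy1]
      linarith [hdec y hy.2]
  linarith [hmin x trivial]

/-- If the costs of two chains agree on a set `C` that is closed and reached from every state,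
and on `C` the costs are a coboundary for one of the chains, then the harmonic part for the other
one vanishes. -/
lemma harmonic_eq_zero_of_agree {p p' : X → PMF X} {C : Set X} (hC : Closed p C)
    (hp : ∀ x ∈ C, p' x = p x) (hreach : ∀ x, ∃ y ∈ C, Relation.ReflTransGen (Step p') x y)
    {f f' k : X → ℝ} (hk : avg p' k = k)
    (hdec : ∀ x ∈ C, f x - avg p f x = f' x - avg p' f' x + k x) (x : X) : k x = 0 := by
  refine le_antisymm ?_ (harmonic_nonneg_of_agree hC hp hreach hk hdec x)
  have := harmonic_nonneg_of_agree hC hp hreach (f := -f) (f' := -f') (k := -k)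
    (by rw [map_neg, hk]) (fun y hy => by
      simp only [map_neg, Pi.neg_apply]; linarith [hdec y hy]) x
  simpa using this

variable [MeasurableSpace X] [DiscreteMeasurableSpace X]

lemma ae_tendsto_average {p : X → PMF X} {c f h : X → ℝ} (hh : avg p h = h)
    (hdec : ∀ x, c x = f x - avg p f x + h x) (x : X) :
    ∀ᵐ π ∂(chainLaw p x), ∃ l, Tendsto (fun n => h (π n)) atTop (𝓝 l) ∧
      Tendsto (fun n : ℕ => (n : ℝ)⁻¹ * ∑ i ∈ Finset.range n, c (π i)) atTop (𝓝 l) := by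
  filter_upwards [ae_tendsto_harmonic hh x, ae_tendsto_coboundary p f x] with π ⟨l, hl⟩ h0
  refine ⟨l, hl, ?_⟩
  have := h0.add hl.cesaro
  rw [zero_add] at this
  refine this.congr fun n => ?_
  rw [← mul_add, ← Finset.sum_add_distrib]
  simp_rw [hdec]

/-- The long-run ratio exists almost surely, and it is bounded by the ratios of the harmonic parts
of the costs. -/
lemma ae_tendsto_costRatio {p : X → PMF X} {c₁ c₂ f₁ f₂ h₁ h₂ : X → ℝ} (hh₁ : avg p h₁ = h₁)
    (hh₂ : avg p h₂ = h₂) (hdec₁ : ∀ x, c₁ x = f₁ x - avg p f₁ x + h₁ x)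
    (hdec₂ : ∀ x, c₂ x = f₂ x - avg p f₂ x + h₂ x) (hpos : ∀ x, 0 < h₂ x) (x : X) :
    ∀ᵐ π ∂(chainLaw p x), ∃ r, Tendsto (costRatio c₁ c₂ π) atTop (𝓝 r) ∧
      (∀ m, (∀ y, m * h₂ y ≤ h₁ y) → m ≤ r) ∧ ∀ m, (∀ y, h₁ y ≤ m * h₂ y) → r ≤ m := by
  obtain ⟨x₀, -, hmin⟩ := Set.exists_min_image Set.univ h₂ (Set.toFinite _) ⟨x, trivial⟩
  filter_upwards [ae_tendsto_average hh₁ hdec₁ x, ae_tendsto_average hh₂ hdec₂ x]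
    with π ⟨l₁, hl₁, ha₁⟩ ⟨l₂, hl₂, ha₂⟩
  -- Finiteness of `X` bounds `h₂` away from 0, so its limit along the path is positive.
  have hl₂pos : 0 < l₂ := (hpos x₀).trans_le (ge_of_tendsto' hl₂ fun n => hmin _ trivial)
  refine ⟨l₁ / l₂, ?_, fun m hm => ?_, fun m hm => ?_⟩
  · refine (ha₁.div ha₂ hl₂pos.ne').congr' ?_
    filter_upwards [eventually_gt_atTop 0] with n hn
    have : (n : ℝ)⁻¹ ≠ 0 := by positivity
    simp only [Pi.div_apply, costRatio]
    exact mul_div_mul_left _ _ this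
  · rw [le_div_iff₀ hl₂pos]
    exact le_of_tendsto_of_tendsto' (hl₂.const_mul m) hl₁ fun n => hm _
  · rw [div_le_iff₀ hl₂pos]
    exact le_of_tendsto_of_tendsto' hl₁ (hl₂.const_mul m) fun n => hm _

omit [MeasurableSpace X] [DiscreteMeasurableSpace X] in
lemma exists_ratio_bounds (h₁ : X → ℝ) {h₂ : X → ℝ} (hpos : ∀ x, 0 < h₂ x) :
    ∃ B, ∀ y, h₁ y ≤ B * h₂ y ∧ -B * h₂ y ≤ h₁ y := by
  obtain ⟨B, -, hB⟩ := exists_bdd fun y => h₁ y / h₂ y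
  refine ⟨B, fun y => ?_⟩
  rw [← div_le_iff₀ (hpos y), ← le_div_iff₀ (hpos y)]
  exact ⟨(abs_le.mp (hB y)).2, (abs_le.mp (hB y)).1⟩

lemma measurable_costRatio (c₁ c₂ : X → ℝ) (n : ℕ) :
    Measurable fun π : ℕ → X => costRatio c₁ c₂ π n :=
  (Finset.measurable_sum _ fun i _ => (measurable_of_finite c₁).comp (measurable_pi_apply i)).div
    (Finset.measurable_sum _ fun i _ => (measurable_of_finite c₂).comp (measurable_pi_apply i))

/-- For proper costs the long-run ratio exists almost surely and is integrable. -/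
lemma Proper.ratio_wellDefined {p : X → PMF X} {c₂ : X → ℝ} (hc : Proper p c₂) (c₁ : X → ℝ)
    (x : X) : (∀ᵐ π ∂(chainLaw p x), ∃ r, Tendsto (costRatio c₁ c₂ π) atTop (𝓝 r)) ∧
      Integrable (fun π => limUnder atTop (costRatio c₁ c₂ π)) (chainLaw p x) := by
  obtain ⟨f₁, h₁, hh₁, hdec₁⟩ := exists_decomposition p c₁
  obtain ⟨f₂, h₂, hh₂, hdec₂⟩ := exists_decomposition p c₂
  have hpos := harmonic_part_pos hc.1 hc.2 hh₂ hdec₂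
  have hae := ae_tendsto_costRatio hh₁ hh₂ hdec₁ hdec₂ hpos x
  obtain ⟨B, hB⟩ := exists_ratio_bounds h₁ hpos
  refine ⟨hae.mono fun π ⟨r, hr, _⟩ => ⟨r, hr⟩, Integrable.of_bound (C := B) ?_ ?_⟩
  · refine aestronglyMeasurable_of_tendsto_ae atTop
      (fun n => (measurable_costRatio c₁ c₂ n).aestronglyMeasurable) ?_
    filter_upwards [hae] with π ⟨r, hr, _⟩
    rwa [hr.limUnder_eq]
  · filter_upwards [hae] with π ⟨r, hr, hl, hu⟩
    rw [hr.limUnder_eq, Real.norm_eq_abs, abs_le]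
    exact ⟨hl _ fun y => (hB y).2, hu _ fun y => (hB y).1⟩

/-- Some irreducible closed set `C` has the least long-run ratio `m`, and every chain that agrees
with the given one on `C` and reaches `C` from everywhere has the ratio `m`. -/
theorem Proper.exists_min_class {p : X → PMF X} {c₂ : X → ℝ} (hc : Proper p c₂) (c₁ : X → ℝ)
    [Nonempty X] :
    ∃ (C : Set X) (m : ℝ), C.Nonempty ∧ Closed p C ∧
      (∀ x ∈ C, ∀ y ∈ C, Relation.ReflTransGen (Step p) x y) ∧
      (∀ x, ∀ᵐ π ∂(chainLaw p x), ∃ r, m ≤ r ∧ Tendsto (costRatio c₁ c₂ π) atTop (𝓝 r)) ∧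
      ∀ (p' : X → PMF X) (c₁' c₂' : X → ℝ), Proper p' c₂' →
        (∀ x ∈ C, p' x = p x ∧ c₁' x = c₁ x ∧ c₂' x = c₂ x) →
        (∀ x, ∃ y ∈ C, Relation.ReflTransGen (Step p') x y) →
        ∀ x, ∀ᵐ π ∂(chainLaw p' x), Tendsto (costRatio c₁' c₂' π) atTop (𝓝 m) := by
  obtain ⟨f₁, h₁, hh₁, hdec₁⟩ := exists_decomposition p c₁
  obtain ⟨f₂, h₂, hh₂, hdec₂⟩ := exists_decomposition p c₂
  have hpos := harmonic_part_pos hc.1 hc.2 hh₂ hdec₂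
  obtain ⟨x₀, -, hmin⟩ := Set.exists_min_image Set.univ (fun x => h₁ x / h₂ x) (Set.toFinite _)
    Set.univ_nonempty
  set m := h₁ x₀ / h₂ x₀ with hm
  have hle : ∀ x, m * h₂ x ≤ h₁ x := fun x => (le_div_iff₀ (hpos x)).mp (hmin x trivial)
  have hharm : avg p (h₁ - m • h₂) = h₁ - m • h₂ := by rw [map_sub, map_smul, hh₁, hh₂]
  -- Here 0 is the minimum of a harmonic function, attained at `x₀`.
  have hZ : Closed p {x | (h₁ - m • h₂) x = 0} := closed_argmin hharm fun x => by
    simpa using hle x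
  obtain ⟨C, hCZ, hne, hC, hirr⟩ := hZ.exists_irreducible ⟨x₀, by
    simp only [Set.mem_ofPred_eq, Pi.sub_apply, Pi.smul_apply, smul_eq_mul, hm]
    rw [div_mul_cancel₀ _ (hpos x₀).ne', sub_self]⟩
  refine ⟨C, m, hne, hC, hirr, fun x => ?_, fun p' c₁' c₂' hc' hagree hreach x => ?_⟩
  · filter_upwards [ae_tendsto_costRatio hh₁ hh₂ hdec₁ hdec₂ hpos x] with π ⟨r, hr, hl, _⟩
    exact ⟨r, hl m hle, hr⟩
  · obtain ⟨f₁', h₁', hh₁', hdec₁'⟩ := exists_decomposition p' c₁'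
    obtain ⟨f₂', h₂', hh₂', hdec₂'⟩ := exists_decomposition p' c₂'
    have hpos' := harmonic_part_pos hc'.1 hc'.2 hh₂' hdec₂'
    -- On `C` the harmonic part of `c₁ - m c₂` under `p` is 0, which leaves the coboundary of `f₁ -
    -- m f₂`.
    have h0 := harmonic_eq_zero_of_agree hC (fun y hy => (hagree y hy).1) hreach
      (f := f₁ - m • f₂) (f' := f₁' - m • f₂') (k := h₁' - m • h₂')
      (by rw [map_sub, map_smul, hh₁', hh₂']) fun y hy => by
        have hz : h₁ y - m * h₂ y = 0 := hCZ hy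
        obtain ⟨-, e₁, e₂⟩ := hagree y hy
        simp only [map_sub, map_smul, Pi.sub_apply, Pi.smul_apply, smul_eq_mul]
        rw [hdec₁, hdec₁'] at e₁
        rw [hdec₂, hdec₂'] at e₂
        linear_combination -e₁ + m * e₂ - hz
    have heq : ∀ y, h₁' y = m * h₂' y := fun y => sub_eq_zero.mp (h0 y)
    filter_upwards [ae_tendsto_costRatio hh₁' hh₂' hdec₁' hdec₂' hpos' x] with π ⟨r, hr, hl, hu⟩
    rwa [le_antisymm (hl m fun y => (heq y).ge) (hu m fun y => (heq y).le)]

end Ratio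

end FiniteChain

namespace FiniteChain

/-! ### Recurrence in terms of accessibility -/

section Recurrence

variable {X : Type*} [Fintype X] [MeasurableSpace X] [DiscreteMeasurableSpace X]

/-- The set of paths that avoid `s`. -/
def avoid (s : X) : Set (ℕ → X) := {π | ∀ n, π n ≠ s}

lemma measurableSet_avoid (s : X) : MeasurableSet (avoid s) := by
  have : avoid s = ⋂ n, (fun π : ℕ → X => π n) ⁻¹' {s}ᶜ := by
    ext π; simp [avoid]
  rw [this]
  exact MeasurableSet.iInter fun n => measurable_pi_apply n (measurableSet_singleton _).compl

/-- The probability of never visiting `s`. -/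
def avoidProb (p : X → PMF X) (s y : X) : ℝ := (chainLaw p y).real (avoid s)

lemma avoidProb_self (p : X → PMF X) (s : X) : avoidProb p s s = 0 := by
  rw [avoidProb, measureReal_eq_zero_iff]
  exact measure_mono_null (t := {π | ¬ π 0 = s}) (fun π hπ => hπ 0)
    (ae_iff.mp (ae_chainLaw_zero p s))

lemma avg_avoidProb (p : X → PMF X) (s y : X) :
    avg p (avoidProb p s) y = (chainLaw p y).real {π | ∀ n, π (n + 1) ≠ s} := by
  rw [measureReal_def]
  refine Eq.trans ?_ (congrArg ENNReal.toReal
    (chainLaw_shift p y (measurableSet_avoid s))).symm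
  rw [tsum_fintype, ENNReal.toReal_sum fun z _ =>
    ENNReal.mul_ne_top (PMF.apply_ne_top _ _) (measure_ne_top _ _)]
  simp [avg_apply, avoidProb, measureReal_def]

/-- Away from `s` the condition at time 0 is void, so the avoidance probability is harmonic there.
-/
lemma avoidProb_eq_avg (p : X → PMF X) {s y : X} (h : y ≠ s) :
    avoidProb p s y = avg p (avoidProb p s) y := by
  rw [avg_avoidProb, avoidProb]
  refine measureReal_congr ?_
  filter_upwards [ae_chainLaw_zero p y] with π hπ
  refine propext ⟨fun H n => H (n + 1), fun H n => ?_⟩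
  rcases n with _ | n
  · rwa [hπ]
  · exact H n

lemma avoidProb_pos_of_step {p : X → PMF X} {s y z : X} (hyz : Step p y z)
    (hz : 0 < avoidProb p s z) : 0 < avg p (avoidProb p s) y := by
  rw [avg_apply]
  refine Finset.sum_pos' (fun w _ => mul_nonneg ENNReal.toReal_nonneg measureReal_nonneg)
    ⟨z, Finset.mem_univ z, mul_pos (ENNReal.toReal_pos hyz.ne' (PMF.apply_ne_top _ _)) hz⟩

lemma Closed.ae_mem {p : X → PMF X} {W : Set X} (hW : Closed p W) (n : ℕ) {y : X} (hy : y ∈ W) :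
    ∀ᵐ π ∂(chainLaw p y), π n ∈ W := by
  induction n generalizing y with
  | zero => exact (ae_chainLaw_zero p y).mono fun π h => h ▸ hy
  | succ n ih =>
    have hm : MeasurableSet {π : ℕ → X | ¬ π n ∈ W} :=
      (measurable_pi_apply n : Measurable fun π : ℕ → X => π n)
      (MeasurableSet.of_discrete : MeasurableSet Wᶜ)
    rw [ae_iff]
    refine (chainLaw_shift p y hm).trans ?_
    rw [ENNReal.tsum_eq_zero]
    intro z
    by_cases hz : Step p y z
    · rw [ae_iff.mp (ih (hW y hy z hz)), mul_zero]
    · have : p y z = 0 := by simpa [Step] using hz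
      rw [this, zero_mul]

lemma avoidProb_pos_of_closed {p : X → PMF X} {W : Set X} (hW : Closed p W) {s y : X}
    (hy : y ∈ W) (hs : s ∉ W) : 0 < avoidProb p s y := by
  have h : avoid s =ᵐ[chainLaw p y] Set.univ := by
    refine eventuallyEq_univ.mpr ?_
    filter_upwards [ae_all_iff.mpr fun n => hW.ae_mem n hy] with π hπ n
    exact fun h => hs (h ▸ hπ n)
  rw [avoidProb, measureReal_congr h]
  simp

/-- The chain almost surely returns to `s` iff `s` is accessible from all states that are accessible
from it. -/
theorem never_return_eq_zero_iff (p : X → PMF X) (s : X) :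
    chainLaw p s {π | ∀ n, π (n + 1) ≠ s} = 0 ↔
      ∀ t, Relation.ReflTransGen (Step p) s t → Relation.ReflTransGen (Step p) t s := by
  rw [← measureReal_eq_zero_iff, ← avg_avoidProb]
  constructor
  · intro h0 t hst
    by_contra hts
    have ht : 0 < avoidProb p s t := by
      have hcl : Closed p {y | ¬ Relation.ReflTransGen (Step p) y s} :=
        fun y hy z hyz hz => hy (hz.head hyz)
      exact avoidProb_pos_of_closed hcl hts (fun h => h .refl)
    -- Positivity spreads backwards from `t` by harmonicity; a passage through `s` would contradict
    -- `h0`.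
    have key : ∀ y, Relation.ReflTransGen (Step p) y t → 0 < avoidProb p s y := by
      intro y hy
      induction hy using Relation.ReflTransGen.head_induction_on with
      | refl => exact ht
      | @head y z hyz _ ih =>
        have h1 := avoidProb_pos_of_step hyz ih
        by_cases hys : y = s
        · rw [hys] at h1
          exact absurd h0 h1.ne'
        · rwa [avoidProb_eq_avg p hys]
    exact absurd (avoidProb_self p s) (key s hst).ne'
  · intro h
    obtain ⟨y₀, hy₀, hmax⟩ := Set.exists_max_image {y | Relation.ReflTransGen (Step p) s y}
      (avoidProb p s) (Set.toFinite _) ⟨s, .refl⟩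
    -- Maximum principle: a positive maximum over the states accessible from `s` is attained on a
    -- closed set, as it is not attained at `s`. But `y₀` leads back to `s`, where the value is 0.
    have hle : avoidProb p s y₀ ≤ 0 := by
      by_contra! hpos
      have hW : Closed p {y | Relation.ReflTransGen (Step p) s y ∧
          avoidProb p s y = avoidProb p s y₀} := by
        rintro y ⟨hy, hye⟩ z hz
        refine ⟨hy.tail hz, ?_⟩
        have hys : y ≠ s := by
          rintro rfl
          rw [avoidProb_self] at hye
          exact hpos.ne hye
        have := eq_of_avg_le (p := p) (f := -avoidProb p s) (c := -avoidProb p s y₀) (x := y)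
          (fun w hw => neg_le_neg (hmax w (hy.tail hw)))
          (by rw [map_neg, Pi.neg_apply, ← avoidProb_eq_avg p hys, hye]) z hz
        exact neg_injective this
      have := (hW.mem_of_reflTransGen ⟨hy₀, rfl⟩ (h y₀ hy₀)).2
      rw [avoidProb_self] at this
      exact hpos.ne this
    refine le_antisymm ?_ ?_
    · have := le_avg (p := p) (f := -avoidProb p s) (c := 0) (x := s) fun y hy => by
        have := hmax y (.single hy)
        simp only [Pi.neg_apply]
        linarith
      rw [map_neg, Pi.neg_apply] at this
      linarith
    · exact le_avg fun y _ => measureReal_nonneg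

end Recurrence

end FiniteChain

/-! ### Reaching a set through a rank function; transfer of paths between chains -/

namespace FiniteChain

/-- If `C` is reachable from everywhere, some rank function decreases along suitable edges outside
`C`. -/
lemma exists_rank {X : Type*} (r : X → X → Prop) (C : Set X)
    (hreach : ∀ x, ∃ y ∈ C, Relation.ReflTransGen r x y) :
    ∃ rank : X → ℕ, ∀ x ∉ C, ∃ y, r x y ∧ rank y < rank x := by
  -- `B n` holds the states with a path of exactly `n` edges into `C`; the rank is the least such
  -- `n`.
  let B : ℕ → Set X := fun n => Nat.rec C (fun _ B => {x | ∃ y ∈ B, r x y}) n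
  have hB : ∀ x, ∃ n, x ∈ B n := by
    intro x
    obtain ⟨y, hy, hxy⟩ := hreach x
    induction hxy using Relation.ReflTransGen.head_induction_on with
    | refl => exact ⟨0, hy⟩
    | head h _ ih =>
      obtain ⟨n, hn⟩ := ih
      exact ⟨n + 1, _, hn, h⟩
  choose rank hspec hmin using fun x =>
    WellFounded.has_min (α := ℕ) wellFounded_lt {n | x ∈ B n} (hB x)
  refine ⟨rank, fun x hx => ?_⟩
  have hx' : x ∈ B (rank x) := hspec x
  rcases hn : rank x with _ | n
  · rw [hn] at hx'
    exact absurd hx' hx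
  · rw [hn] at hx'
    obtain ⟨y, hy, hxy⟩ := hx'
    exact ⟨y, hxy, Nat.lt_succ_of_le (not_lt.mp (hmin y n hy))⟩

lemma Closed.reflTransGen_congr {X : Type*} {p p' : X → PMF X} {C : Set X} (hC : Closed p C)
    (hp : ∀ x ∈ C, p' x = p x) {x y : X} (hx : x ∈ C) (h : Relation.ReflTransGen (Step p) x y) :
    Relation.ReflTransGen (Step p') x y := by
  induction h with
  | refl => exact .refl
  | @tail b c hb hbc ih =>
    exact ih.tail (by rw [Step, hp b (hC.mem_of_reflTransGen hx hb)]; exact hbc)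

end FiniteChain

/-! ### Application to policies on end components -/

namespace SubMA

variable {S A : Type*} {M : MarkovAutomaton S A} {E : SubMA M}

lemma eq_none_of_mem_MS {s : E.states} {σ : Option A} (hσ : σ ∈ E.acts s) (hs : (s : S) ∈ M.MS) :
    σ = none := by
  rcases E.acts_enabled s hσ with ⟨α, μ, rfl, hμ⟩ | ⟨rfl, -⟩
  · obtain ⟨l, s', hl⟩ := hs
    exact absurd hl (M.not_both _ _ _ _ _ hμ)
  · rfl

variable [Fintype S]

lemma P_some {s : S} {α : A} {μ : PMF S} (h : M.ptrans s α μ) (t : S) :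
    M.P s (some α) t = (μ t).toReal := by
  have h' : ∃ μ, M.ptrans s α μ := ⟨μ, h⟩
  simp only [MarkovAutomaton.P, dif_pos h']
  rw [M.ptrans_unique _ _ _ _ h'.choose_spec h]

lemma P_some_pos {s : S} {α : A} {μ : PMF S} (h : M.ptrans s α μ) {t : S} :
    0 < M.P s (some α) t ↔ 0 < μ t := by
  rw [P_some h, ENNReal.toReal_pos_iff]
  exact and_iff_left (PMF.apply_lt_top _ _)

lemma P_none_pos {s t : S} : 0 < M.P s none t ↔ ∃ l, (s, l, t) ∈ M.mtrans := by
  constructor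
  · intro h
    simp only [MarkovAutomaton.P] at h
    split_ifs at h with hs
    · refine M.exists_mem_of_rate_ne_zero fun h0 => ?_
      simp [h0] at h
    · exact absurd h (lt_irrefl _)
  · rintro ⟨l, hl⟩
    have hs : s ∈ M.MS := ⟨l, t, hl⟩
    simp only [MarkovAutomaton.P, if_pos hs]
    exact div_pos (M.rate_pos_of_mem hl) (M.exitRate_pos hs)

/-- Markovian edges do not mention the retained actions, but in a Markovian state the nonempty set
of retained actions can only contain `none`. -/
lemma edge_iff {s t : E.states} : E.Edge s t ↔ ∃ σ ∈ E.acts s, 0 < M.P s σ t := by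
  constructor
  · rintro (⟨α, μ, hα, hμ, h⟩ | ⟨l, hl⟩)
    · exact ⟨some α, hα, (P_some_pos hμ).mpr h⟩
    · obtain ⟨σ, hσ⟩ := E.acts_nonempty s
      obtain rfl := eq_none_of_mem_MS hσ ⟨l, t, hl⟩
      exact ⟨none, hσ, P_none_pos.mpr ⟨l, hl⟩⟩
  · rintro ⟨σ, hσ, h⟩
    rcases E.acts_enabled s hσ with ⟨α, μ, rfl, hμ⟩ | ⟨rfl, -⟩
    · exact .inl ⟨α, μ, hσ, hμ, (P_some_pos hμ).mp h⟩
    · exact .inr (P_none_pos.mp h)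

namespace Policy

open FiniteChain

lemma step_apply (D : E.Policy) (s t : E.states) :
    D.step s t = ENNReal.ofReal (M.P s (D.act s) t) := rfl

lemma step_iff (D : E.Policy) {s t : E.states} : Step D.step s t ↔ 0 < M.P s (D.act s) t := by
  rw [Step, step_apply, ENNReal.ofReal_pos]

lemma accessible_iff (D : E.Policy) {s t : E.states} :
    D.Accessible s t ↔ Relation.ReflTransGen (Step D.step) s t := by
  have : Step D.step = fun u v : E.states => 0 < M.P u (D.act u) v :=
    funext fun u => funext fun v => propext D.step_iff
  rw [this]
  rfl

/-- Replaces the path-measure definition by a graph condition, so that recurrent classes can be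
found combinatorially. -/
lemma isRecurrent_iff (D : E.Policy) {s : E.states} : D.IsRecurrent s ↔
    ∀ t, Relation.ReflTransGen (Step D.step) s t → Relation.ReflTransGen (Step D.step) t s := by
  let _ := Fintype.ofFinite E.states
  rw [← never_return_eq_zero_iff, IsRecurrent, IsTransient, not_lt, nonpos_iff_eq_zero]
  rfl

/-- A closed irreducible set that is reached from every state is the only recurrent class. -/
lemma isUnichain_of_irreducible (D : E.Policy) {C : Set E.states} (hne : C.Nonempty)
    (hC : Closed D.step C)
    (hirr : ∀ x ∈ C, ∀ y ∈ C, Relation.ReflTransGen (Step D.step) x y)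
    (hreach : ∀ x, ∃ y ∈ C, Relation.ReflTransGen (Step D.step) x y) : D.IsUnichain := by
  have hrec : ∀ s ∈ C, D.IsRecurrent s := fun s hs =>
    D.isRecurrent_iff.mpr fun t ht => hirr t (hC.mem_of_reflTransGen hs ht) s hs
  have hclass : ∀ s ∈ C, C = {t | D.IsRecurrent t ∧ D.Accessible s t ∧ D.Accessible t s} := by
    intro s hs
    ext t
    simp only [Set.mem_ofPred_eq, accessible_iff]
    exact ⟨fun ht => ⟨hrec t ht, hirr s hs t ht, hirr t ht s hs⟩,
      fun ht => hC.mem_of_reflTransGen hs ht.2.1⟩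
  obtain ⟨s, hs⟩ := hne
  refine ⟨C, ⟨s, hrec s hs, hclass s hs⟩, ?_⟩
  rintro C' ⟨s', hs', rfl⟩
  -- A recurrent `s'` is accessible from the point `y` of `C` that it reaches, so closedness puts
  -- `s'` in `C`.
  obtain ⟨y, hy, hsy⟩ := hreach s'
  exact (hclass s' (hC.mem_of_reflTransGen hy (D.isRecurrent_iff.mp hs' y hsy))).symm

/-- The end component formed by a nonempty closed set of states and the actions of a policy. -/
def subMA (D : E.Policy) (C : Set E.states) (hne : C.Nonempty) (hC : Closed D.step C) :
    SubMA M where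
  states := Subtype.val '' C
  acts s := {D.act ⟨s, Subtype.coe_image_subset _ _ s.2⟩}
  states_nonempty := hne.image _
  acts_enabled s := by
    rintro _ rfl
    exact E.acts_enabled _ (D.act_mem _)
  acts_nonempty s := Set.singleton_nonempty _
  closed_prob := by
    rintro ⟨_, s, hs, rfl⟩ α μ s' hα hμ hpos
    have hα' : some α = D.act s := hα
    have hs' := E.closed_prob s α μ s' (hα' ▸ D.act_mem s) hμ hpos
    refine ⟨⟨s', hs'⟩, hC s hs _ (D.step_iff.mpr ?_), rfl⟩
    rw [← hα']
    exact (P_some_pos hμ).mpr hpos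
  closed_markov := by
    rintro ⟨_, s, hs, rfl⟩ l s' hl
    have hs' := E.closed_markov s l s' hl
    refine ⟨⟨s', hs'⟩, hC s hs _ (D.step_iff.mpr ?_), rfl⟩
    rw [eq_none_of_mem_MS (D.act_mem s) ⟨l, s', hl⟩]
    exact P_none_pos.mpr ⟨l, hl⟩

lemma subMA_isEndComponent (D : E.Policy) (C : Set E.states) (hne : C.Nonempty)
    (hC : Closed D.step C)
    (hirr : ∀ x ∈ C, ∀ y ∈ C, Relation.ReflTransGen (Step D.step) x y) :
    (D.subMA C hne hC).IsEndComponent := by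
  have key : ∀ x (hx : x ∈ C) y, Relation.ReflTransGen (Step D.step) x y → ∀ hy : y ∈ C,
      Relation.ReflTransGen (D.subMA C hne hC).Edge ⟨x, x, hx, rfl⟩ ⟨y, y, hy, rfl⟩ := by
    intro x hx y h
    induction h with
    | refl => exact fun _ => .refl
    | @tail b c hb hbc ih =>
      intro hc
      exact (ih (hC.mem_of_reflTransGen hx hb)).tail
        (edge_iff.mpr ⟨D.act b, rfl, D.step_iff.mp hbc⟩)
  rintro ⟨_, s, hs, rfl⟩ ⟨_, t, ht, rfl⟩
  exact key s hs t (hirr s hs t ht) ht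

lemma subMA_containedIn (D : E.Policy) (C : Set E.states) (hne : C.Nonempty)
    (hC : Closed D.step C) : (D.subMA C hne hC).ContainedIn E := by
  refine ⟨Subtype.coe_image_subset _ _, fun s => ?_⟩
  rintro _ rfl
  exact D.act_mem _

lemma cost₂_nonneg (s : S) (σ : Option A) : 0 ≤ M.cost₂ s σ := by
  unfold MarkovAutomaton.cost₂
  split_ifs with h
  · exact one_div_nonneg.mpr (M.exitRate_pos h.1).le
  · exact le_rfl

lemma ratio_eq_costRatio (D : E.Policy) (G : Set S) (π : ℕ → E.states) :
    D.ratio G π = costRatio (fun s : E.states => M.cost₁ G s (D.act s))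
      (fun s => M.cost₂ s (D.act s)) π := rfl

/-- In a non-Zeno component time passes in every closed set of states. -/
lemma proper_cost₂ (hZ : E.NonZeno) (D : E.Policy) :
    Proper D.step fun s => M.cost₂ s (D.act s) := by
  refine ⟨fun s => cost₂_nonneg _ _, fun W hW hne => ?_⟩
  obtain ⟨C, hCW, hCne, hC, hirr⟩ := hW.exists_irreducible hne
  -- The irreducible part with the actions of `D` is an end component inside `E`, so it has a
  -- Markovian state, whose expected delay is positive.
  obtain ⟨_, ⟨s, hs, rfl⟩, hMS⟩ := hZ _ (D.subMA_isEndComponent C hCne hC hirr)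
    (D.subMA_containedIn C hCne hC)
  refine ⟨s, hCW hs, ?_⟩
  beta_reduce
  rw [eq_none_of_mem_MS (D.act_mem s) hMS, MarkovAutomaton.cost₂, if_pos ⟨hMS, rfl⟩]
  exact (one_div_pos.mpr (M.exitRate_pos hMS)).ne'

lemma ratioWellDefined (hZ : E.NonZeno) (D : E.Policy) (G : Set S) : D.RatioWellDefined G := by
  let _ := Fintype.ofFinite E.states
  exact (D.proper_cost₂ hZ).ratio_wellDefined fun s => M.cost₁ G s (D.act s)

/-- In an end component a policy can be changed outside a set of states so that this set is reached
with positive probability from everywhere. -/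
lemma exists_reaching (hE : E.IsEndComponent) (D : E.Policy) {C : Set E.states}
    (hne : C.Nonempty) : ∃ D' : E.Policy, (∀ s ∈ C, D'.act s = D.act s) ∧
      ∀ s, ∃ y ∈ C, Relation.ReflTransGen (Step D'.step) s y := by
  classical
  obtain ⟨y₀, hy₀⟩ := hne
  obtain ⟨rank, hrank⟩ := exists_rank E.Edge C fun x => ⟨y₀, hy₀, hE x y₀⟩
  -- Outside `C` an action is chosen that lowers the rank with positive probability; its other
  -- outcomes may raise it, which does not affect reachability.
  have hact : ∀ s, ∃ σ ∈ E.acts s, (s ∈ C → σ = D.act s) ∧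
      (s ∉ C → ∃ t : E.states, 0 < M.P s σ t ∧ rank t < rank s) := by
    intro s
    by_cases hs : s ∈ C
    · exact ⟨D.act s, D.act_mem s, fun _ => rfl, fun h => absurd hs h⟩
    · obtain ⟨t, hst, ht⟩ := hrank s hs
      obtain ⟨σ, hσ, hpos⟩ := edge_iff.mp hst
      exact ⟨σ, hσ, fun h => absurd h hs, fun _ => ⟨t, hpos, ht⟩⟩
  choose a ha haC hastep using hact
  refine ⟨⟨a, ha⟩, haC, fun s => ?_⟩
  induction hn : rank s using Nat.strong_induction_on generalizing s with
  | _ n ih =>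
    by_cases hs : s ∈ C
    · exact ⟨s, hs, .refl⟩
    · obtain ⟨t, hpos, ht⟩ := hastep s hs
      obtain ⟨y, hy, hty⟩ := ih _ (hn ▸ ht) t rfl
      exact ⟨y, hy, hty.head (step_iff _ |>.mpr hpos)⟩

/-- Some unichain policy is at least as good as `D` for the minimisation of the scaled ratio. -/
lemma exists_unichain_mul_expRatio_le (hE : E.IsEndComponent) (hZ : E.NonZeno) (D : E.Policy)
    (G : Set S) (a : ℝ) : ∃ D' : E.Policy, D'.IsUnichain ∧ D'.RatioWellDefined G ∧
      ∀ s, a * D'.expRatio G s ≤ a * D.expRatio G s := by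
  let _ := Fintype.ofFinite E.states
  have : Nonempty E.states := E.states_nonempty.to_subtype
  -- The factor `a` is absorbed into the first cost, so its sign selects the objective.
  obtain ⟨C, m, hne, hC, hirr, hm, hmin⟩ := (D.proper_cost₂ hZ).exists_min_class
    fun s => a * M.cost₁ G s (D.act s)
  obtain ⟨D', hagree, hreach⟩ := exists_reaching hE D hne
  have hstep : ∀ s ∈ C, D'.step s = D.step s := fun s hs => by
    ext t
    rw [step_apply, step_apply, hagree s hs]
  have hC' : Closed D'.step C := fun x hx y hy => hC x hx y (by rwa [Step, ← hstep x hx])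
  have hm' := hmin D'.step (fun s => a * M.cost₁ G s (D'.act s)) (fun s => M.cost₂ s (D'.act s))
    (D'.proper_cost₂ hZ) (fun s hs => ⟨hstep s hs, by rw [hagree s hs], by rw [hagree s hs]⟩) hreach
  refine ⟨D', D'.isUnichain_of_irreducible hne hC' (fun x hx y hy =>
    hC.reflTransGen_congr hstep hx (hirr x hx y hy)) hreach, D'.ratioWellDefined hZ G, fun s => ?_⟩
  have hscale : ∀ (D : E.Policy) (π : ℕ → E.states) (r l : ℝ),
      Tendsto (D.ratio G π) atTop (𝓝 r) →
      Tendsto (costRatio (fun s : E.states => a * M.cost₁ G s (D.act s))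
        (fun s => M.cost₂ s (D.act s)) π)
        atTop (𝓝 l) → a * D.longRunRatio G π = l := by
    intro D π r l hr hl
    rw [longRunRatio, hr.limUnder_eq]
    refine tendsto_nhds_unique ((hr.const_mul a).congr fun n => ?_) hl
    rw [costRatio_const_mul, ratio_eq_costRatio]
  have hwd := D.ratioWellDefined hZ G s
  have : IsProbabilityMeasure (D.Pr s) := inferInstanceAs (IsProbabilityMeasure (chainLaw _ _))
  have : IsProbabilityMeasure (D'.Pr s) := inferInstanceAs (IsProbabilityMeasure (chainLaw _ _))
  have h' : a * D'.expRatio G s = m := by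
    have hae : (fun π => a * D'.longRunRatio G π) =ᵐ[D'.Pr s] fun _ => m := by
      filter_upwards [(D'.ratioWellDefined hZ G s).1, hm' s] with π ⟨r, hr⟩ hl
      exact hscale D' π r m hr hl
    rw [expRatio, ← integral_const_mul, integral_congr_ae hae]
    simp
  have h : m ≤ a * D.expRatio G s := by
    have hae : (fun _ => m) ≤ᵐ[D.Pr s] fun π => a * D.longRunRatio G π := by
      filter_upwards [hwd.1, hm s] with π ⟨r, hr⟩ ⟨l, hml, hl⟩
      rwa [hscale D π r l hr hl]
    have := integral_mono_ae (integrable_const m) (hwd.2.const_mul a) hae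
    rw [expRatio, ← integral_const_mul]
    simpa using this
  exact h'.trans_le h

end Policy

end SubMA

end

theorem lemma4p3 {S A : Type*} [Fintype S] [Finite A] (M : MarkovAutomaton S A) (G : Set S)
    (E : SubMA M) (hE : E.IsMaximalEndComponent) (hZ : E.NonZeno)
    (D : E.Policy) (hD : D.IsMultichain) :
    D.RatioWellDefined G ∧
    (∃ D' : E.Policy, D'.IsUnichain ∧ D'.RatioWellDefined G ∧
      ∀ s, D'.expRatio G s ≤ D.expRatio G s) ∧
    (∃ D' : E.Policy, D'.IsUnichain ∧ D'.RatioWellDefined G ∧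
      ∀ s, D.expRatio G s ≤ D'.expRatio G s) := by
  refine ⟨D.ratioWellDefined hZ G, ?_, ?_⟩
  · obtain ⟨D', h, hwd, hle⟩ := D.exists_unichain_mul_expRatio_le hE.1 hZ G 1
    exact ⟨D', h, hwd, fun s => by simpa using hle s⟩
  -- Negating the ratio turns maximisation into minimisation.
  · obtain ⟨D', h, hwd, hle⟩ := D.exists_unichain_mul_expRatio_le hE.1 hZ G (-1)
    exact ⟨D', h, hwd, fun s => by simpa using hle s⟩
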